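/- There are absolute constants $c_1,c_2,c_3,\varepsilon_0>0$ such that the following holds for all integers $k\ge 1$ and $d\ge 4k$. There is a three-layer ReLU network without offsets $G:\mathbb R^{k+1}\to\mathbb R^d$, $$G(x)=\sigma\circ(W_3\,\sigma\circ(W_2\,\sigma\circ(W_1x))),\qquad \sigma(t)=\max\{t,0\}\ \text{entrywise},$$ with every layer of width at most $d$, such that with $K=G(\mathbb R^{k+1})\cap\mathbb B_2^d(1)$ (the closed unit ball) the following two statements hold for every number $m$ of observations and every probability distribution $\nu$ on $\mathbb R$ of the dither (for instance $\nu=\mathrm{Unif}[-\lambda,\lambda]$ with any $\lambda>0$). For $\theta_0\in K$, let $(a_i,y_i)_{i=1}^m$ be i.i.d. copies of $(a,y)$ with $$y=\operatorname{sign}(\langle a,\theta_0\rangle+\xi+\tau),$$ where $a\sim\mathcal N(0,\mathbf I_d)$, $\xi\sim\mathcal N(0,1)$ and $\tau\sim\nu$ are independent, and let $\inf_{\hat\theta}$ be the infimum over all (possibly randomized) estimators $\hat\theta\in\mathbb R^d$ that depend only on $(a_i,y_i)_{i=1}^m$ (they may depend on $G$, $m$ and $\nu$). 1. If $m\ge c_1k\log(d/k)$,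 then $$\inf_{\hat\theta}\ \sup_{\theta_0\in K}\ \mathbb E\|\hat\theta-\theta_0\|_2\ \ge\ c_2\sqrt{\frac{k\log(d/k)}{m}}.$$ 2. If $0<\varepsilon\le\varepsilon_0$ and $\inf_{\hat\theta}\sup_{\theta_0\in K}\mathbb E\|\hat\theta-\theta_0\|_2\le\varepsilon$ (in particular, if some estimator has expected error at most $\varepsilon$ uniformly over $K$), then $$m\ \ge\ c_3\,\frac{k\log(d/k)}{\varepsilon^2}.$$ -/

import Mathlib

open MeasureTheory ProbabilityTheory
open scoped ENNReal RealInnerProductSpace Matrix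

noncomputable section

/-- Fully connected ReLU networks without offsets: `ReLUNet n p q` is the type of networks with
`n` layers, input dimension `p` and output dimension `q`, given by their weight matrices.
`N.layer W` puts a further layer with weight matrix `W` on top of `N`. -/
inductive ReLUNet : ℕ → ℕ → ℕ → Type
  | input (p : ℕ) : ReLUNet 0 p p
  | layer {n p q r : ℕ} (N : ReLUNet n p q) (W : Matrix (Fin r) (Fin q) ℝ) : ReLUNet (n + 1) p r

namespace ReLUNet

/-- The map `x ↦ σ ∘ (W_n σ ∘ (W_{n-1} ⋯ σ ∘ (W_1 x)))`, where `σ t = max t 0` acts entrywise. -/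
def eval {n p q : ℕ} : ReLUNet n p q → EuclideanSpace ℝ (Fin p) → EuclideanSpace ℝ (Fin q)
  | input _, x => x
  | layer N W, x => WithLp.toLp 2 fun i => max ((W *ᵥ (N.eval x).ofLp) i) 0

/-- Every layer (the input is not counted as one) has at most `D` nodes. -/
def WidthLE {n p q : ℕ} : ReLUNet n p q → ℕ → Prop
  | input _, _ => True
  | layer (r := r) N _, D => N.WidthLE D ∧ r ≤ D

/-- The signals of norm at most one that the network generates, `G(ℝ^p) ∩ 𝔹₂^q(1)`. -/
def signals {n p q : ℕ} (N : ReLUNet n p q) : Set (EuclideanSpace ℝ (Fin q)) :=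
  Set.range N.eval ∩ Metric.closedBall 0 1

end ReLUNet

/-- The one-bit quantizer with values in `{-1, 1}`. -/
def oneBit (t : ℝ) : ℝ := if 0 ≤ t then 1 else -1

/-- The observations `(a_i, y_i)`, `i < m`, with `y_i = sign (⟨a_i, θ⟩ + ξ_i + τ_i)`, as a function
of the signal `θ` and of the triples `(a_i, ξ_i, τ_i)`. -/
def observe {d m : ℕ} (θ : EuclideanSpace ℝ (Fin d))
    (ω : Fin m → EuclideanSpace ℝ (Fin d) × ℝ × ℝ) : Fin m → EuclideanSpace ℝ (Fin d) × ℝ :=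
  fun i => ((ω i).1, oneBit (⟪(ω i).1, θ⟫ + (ω i).2.1 + (ω i).2.2))

/-- The law of `m` i.i.d. copies of `(a, ξ, τ)`, where the measurement vector `a ∼ N(0, I_d)`, the
noise `ξ ∼ N(0, 1)` and the dither `τ ∼ ν` are independent. -/
def sourceLaw (d m : ℕ) (ν : Measure ℝ) : Measure (Fin m → EuclideanSpace ℝ (Fin d) × ℝ × ℝ) :=
  Measure.pi fun _ => (stdGaussian (EuclideanSpace ℝ (Fin d))).prod ((gaussianReal 0 1).prod ν)

theorem measurable_oneBit : Measurable oneBit :=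
  Measurable.ite measurableSet_Ici measurable_const measurable_const

theorem measurable_observe (d m : ℕ) : Measurable
    fun q : EuclideanSpace ℝ (Fin d) × (Fin m → EuclideanSpace ℝ (Fin d) × ℝ × ℝ) =>
      observe q.1 q.2 := by
  refine measurable_pi_lambda _ fun i => ?_
  have h : Measurable fun q : EuclideanSpace ℝ (Fin d) ×
      (Fin m → EuclideanSpace ℝ (Fin d) × ℝ × ℝ) => q.2 i :=
    (measurable_pi_apply i).comp measurable_snd
  refine h.fst.prodMk (measurable_oneBit.comp ?_)
  exact ((h.fst.inner measurable_fst).add h.snd.fst).add h.snd.snd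

/-- The statistical experiment in which the signal `θ` ranges over `K` and the data are `m` i.i.d.
copies of `(a, y)`, `y = sign (⟨a, θ⟩ + ξ + τ)`, with dither law `ν`: the kernel that maps `θ` to the
law of the data. -/
def oneBitExperiment {d : ℕ} (K : Set (EuclideanSpace ℝ (Fin d))) (m : ℕ) (ν : Measure ℝ)
    [IsProbabilityMeasure ν] : Kernel K (Fin m → EuclideanSpace ℝ (Fin d) × ℝ) where
  toFun θ := (sourceLaw d m ν).map (observe θ.1)
  measurable' := by
    have : IsProbabilityMeasure (sourceLaw d m ν) := by unfold sourceLaw; infer_instance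
    refine Measure.measurable_of_measurable_coe _ fun s hs => ?_
    have h : Measurable fun q : K × (Fin m → EuclideanSpace ℝ (Fin d) × ℝ × ℝ) =>
        observe q.1.1 q.2 :=
      (measurable_observe d m).comp ((measurable_subtype_coe.comp measurable_fst).prodMk
        measurable_snd)
    have e : (fun θ : K => (sourceLaw d m ν).map (observe θ.1) s) =
        fun θ => sourceLaw d m ν (Prod.mk θ ⁻¹' ((fun q => observe q.1.1 q.2) ⁻¹' s)) := by
      funext θ
      exact Measure.map_apply (h.comp (measurable_prodMk_left (x := θ))) hs
    rw [e]
    exact measurable_measure_prodMk_left (h hs)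

/-- The minimax risk `inf_{θ̂} sup_{θ ∈ K} 𝔼 ‖θ̂ - θ‖₂`, in `[0, ∞]`, over all (possibly
randomized) estimators, that is Markov kernels from the data `(a_i, y_i)` to `ℝ^d`. -/
def oneBitMinimaxRisk {d : ℕ} (K : Set (EuclideanSpace ℝ (Fin d))) (m : ℕ) (ν : Measure ℝ)
    [IsProbabilityMeasure ν] : ℝ≥0∞ :=
  minimaxRisk (fun (θ : K) (t : EuclideanSpace ℝ (Fin d)) => ENNReal.ofReal ‖t - θ.1‖)
    (oneBitExperiment K m ν)

end

/-!
The range of a network without offsets is a cone, so it suffices that the network produces one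
finite family of signals at every scale. Let `B = ⌊d / k⌋ - 2` and split `k * B` of the coordinates
into `k` blocks of size `B`. A codeword has one entry `δ` in each block and zeros elsewhere, and its
norm is `δ √k`. The inputs `s, x₁, …, x_k` generate all codewords: the block `j` consists of the hat
functions of `x_j` with nodes `s, …, B s`, which are second differences of `(x_j - l s)₊`; at `s = δ`
and `x_j ∈ {δ, …, B δ}` exactly one of them is nonzero (`hatNet_eval`).

The lower bound for the risk is a Bayes argument with the uniform prior on the codewords, under
which the blocks are independent. Up to a constant, the loss is at least `δ / √k` times the number
of wrongly decoded blocks (`le_norm_sub_codeword_add_indicator`), so it is enough that each block is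
decoded wrongly with probability bounded below, even if the other blocks are known. Then there are
`B` candidates `θ + δ e_p`, with `p` ranging over the block. The quantized data at `θ + Δ` are those
at `θ` with `⟨a_i, Δ⟩` added to the noise (`observe_add`), so they are tilted by a Gaussian likelihood
ratio whatever the dither law is. For `Δ = δ e_p` the second moment of this ratio is
`𝔼 exp (∑ ⟨a_i, Δ⟩²) = (1 - 2 δ²) ^ (-m / 2) ≤ exp (2 m δ²)`
(`lintegral_prod_shiftDensity_sq_le`). By Cauchy–Schwarz, the average over the candidates of the
probability that the right one is accepted is at most `√(exp (2 m δ²) / B)`, because the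
acceptance regions are disjoint. If `4 m δ² ≤ log B`, this is at most `7 / 8`, which is all that is
needed (`sum_lintegral_cell_le`), and `log B` is comparable with `log (d / k)`.

Hence the risk is at least `δ √k / 16` for every `δ` with `k δ² ≤ 1 / 4` and
`12 m δ² ≤ log (d / k)` (`le_oneBitMinimaxRisk_hatNet`). The largest `δ` of this kind gives the
rate, and `δ` proportional to `ε / √k` gives the bound on the number of observations.
-/

noncomputable section

/-! ### Products of densities -/

/-- Tonelli's theorem for products of functions of single coordinates. -/
theorem lintegral_pi_prod_eq_prod {ι X : Type*} [Fintype ι] [MeasurableSpace X]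
    (μ : Measure X) [IsProbabilityMeasure μ] {f : ι → X → ℝ≥0∞} (hf : ∀ i, Measurable (f i)) :
    ∫⁻ x, ∏ i, f i (x i) ∂(Measure.pi fun _ : ι => μ) = ∏ i, ∫⁻ x, f i x ∂μ := by
  have hi : iIndepFun (fun i (x : ι → X) => f i (x i)) (Measure.pi fun _ : ι => μ) :=
    iIndepFun_pi (X := f) fun i => (hf i).aemeasurable
  rw [lintegral_prod_eq_prod_lintegral_of_indepFun Finset.univ _ hi
    fun i => (hf i).comp (measurable_pi_apply i)]
  refine Finset.prod_congr rfl fun i _ => ?_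
  exact (measurePreserving_eval (fun _ : ι => μ) i).lintegral_comp (hf i)

theorem pi_withDensity {ι X : Type*} [Fintype ι] [MeasurableSpace X]
    (μ : Measure X) [IsProbabilityMeasure μ] {f : X → ℝ≥0∞} (hf : Measurable f)
    [SigmaFinite (μ.withDensity f)] :
    Measure.pi (fun _ : ι => μ.withDensity f) =
      (Measure.pi fun _ : ι => μ).withDensity fun x => ∏ i, f (x i) := by
  refine Measure.pi_eq fun s hs => ?_
  rw [withDensity_apply _ (MeasurableSet.univ_pi hs),
    ← lintegral_indicator (MeasurableSet.univ_pi hs)]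
  have e : (Set.univ.pi s).indicator (fun x : ι → X => ∏ i, f (x i)) =
      fun x => ∏ i, (s i).indicator f (x i) := by
    classical
    funext x
    by_cases hx : x ∈ Set.univ.pi s
    · rw [Set.indicator_of_mem hx]
      exact Finset.prod_congr rfl fun i _ => (Set.indicator_of_mem (hx i trivial) _).symm
    · rw [Set.indicator_of_notMem hx]
      simp only [Set.mem_pi, Set.mem_univ, true_implies, not_forall] at hx
      obtain ⟨i, hi⟩ := hx
      exact (Finset.prod_eq_zero (Finset.mem_univ i) (Set.indicator_of_notMem hi _)).symm
  rw [e, lintegral_pi_prod_eq_prod μ fun i => hf.indicator (hs i)]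
  exact Finset.prod_congr rfl fun i _ => by
    rw [lintegral_indicator (hs i), withDensity_apply _ (hs i)]

/-! ### Gaussian shifts -/

theorem lintegral_gaussianReal_eq (f : ℝ → ℝ≥0∞) (hf : Measurable f) :
    ∫⁻ x, f x ∂gaussianReal 0 1 =
      ∫⁻ x, ENNReal.ofReal ((√(2 * Real.pi))⁻¹ * Real.exp (-x ^ 2 / 2)) * f x := by
  rw [gaussianReal_of_var_ne_zero _ one_ne_zero,
    lintegral_withDensity_eq_lintegral_mul _ (measurable_gaussianPDF 0 1) hf]
  simp [gaussianPDF, gaussianPDFReal]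

/-- The density of `N(t, 1)` with respect to `N(0, 1)` is `exp (x t - t ^ 2 / 2)`. -/
theorem lintegral_gaussianReal_add {f : ℝ → ℝ≥0∞} (hf : Measurable f) (t : ℝ) :
    ∫⁻ x, f (x + t) ∂gaussianReal 0 1 =
      ∫⁻ x, ENNReal.ofReal (Real.exp (x * t - t ^ 2 / 2)) * f x ∂gaussianReal 0 1 := by
  rw [lintegral_gaussianReal_eq _ (by fun_prop), lintegral_gaussianReal_eq _ (by fun_prop),
    ← lintegral_sub_right_eq_self _ t]
  refine lintegral_congr fun x => ?_
  rw [sub_add_cancel, ← mul_assoc, ← ENNReal.ofReal_mul (by positivity), mul_assoc, ← Real.exp_add]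
  congr 4
  ring

theorem lintegral_likelihoodRatio_sq_gaussianReal (t : ℝ) :
    ∫⁻ x, ENNReal.ofReal (Real.exp (x * t - t ^ 2 / 2)) ^ 2 ∂gaussianReal 0 1 =
      ENNReal.ofReal (Real.exp (t ^ 2)) := by
  have h := lintegral_gaussianReal_add (f := fun _ => ENNReal.ofReal (Real.exp (t ^ 2)))
    measurable_const (2 * t)
  simp only [lintegral_const, measure_univ, mul_one] at h
  rw [h]
  refine lintegral_congr fun x => ?_
  rw [sq, ← ENNReal.ofReal_mul (by positivity), ← ENNReal.ofReal_mul (by positivity),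
    ← Real.exp_add, ← Real.exp_add]
  congr 2
  ring

/-- The integral is `(1 - 2 δ ^ 2) ^ (-1 / 2)`, and `1 / (1 - x) ≤ exp (2 x)` for `0 ≤ x ≤ 1 / 2`. -/
theorem lintegral_exp_sq_gaussianReal_le {δ : ℝ} (hδ : δ ^ 2 ≤ 1 / 4) :
    ∫⁻ x, ENNReal.ofReal (Real.exp ((δ * x) ^ 2)) ∂gaussianReal 0 1 ≤
      ENNReal.ofReal (Real.exp (2 * δ ^ 2)) := by
  have hb : 0 < 1 / 2 - δ ^ 2 := by linarith
  rw [lintegral_gaussianReal_eq _ (by fun_prop)]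
  have e : ∀ x : ℝ, ENNReal.ofReal ((√(2 * Real.pi))⁻¹ * Real.exp (-x ^ 2 / 2)) *
      ENNReal.ofReal (Real.exp ((δ * x) ^ 2)) =
      ENNReal.ofReal ((√(2 * Real.pi))⁻¹ * Real.exp (-(1 / 2 - δ ^ 2) * x ^ 2)) := fun x => by
    rw [← ENNReal.ofReal_mul (by positivity), mul_assoc, ← Real.exp_add]
    congr 3
    ring
  simp_rw [e]
  rw [← ofReal_integral_eq_lintegral_ofReal ((integrable_exp_neg_mul_sq hb).const_mul _)
    (ae_of_all _ fun x => by positivity), integral_const_mul, integral_gaussian]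
  refine ENNReal.ofReal_le_ofReal ?_
  have hπ := Real.pi_pos
  rw [← Real.sqrt_inv, ← Real.sqrt_mul (by positivity)]
  refine Real.sqrt_le_iff.2 ⟨by positivity, ?_⟩
  rw [← Real.exp_nat_mul]
  have h1 := Real.add_one_le_exp (((2 : ℕ) : ℝ) * (2 * δ ^ 2))
  have h2 : (2 * Real.pi)⁻¹ * (Real.pi / (1 / 2 - δ ^ 2)) = 1 / (1 - 2 * δ ^ 2) := by
    field_simp
  rw [h2, div_le_iff₀ (by linarith)]
  push_cast at h1 ⊢
  nlinarith [sq_nonneg δ]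

/-! ### Moving the signal by tilting the noise -/

/-- The law of a single triple `(a, ξ, τ)`. -/
def sampleLaw (d : ℕ) (ν : Measure ℝ) : Measure (EuclideanSpace ℝ (Fin d) × ℝ × ℝ) :=
  (stdGaussian (EuclideanSpace ℝ (Fin d))).prod ((gaussianReal 0 1).prod ν)

instance (d : ℕ) (ν : Measure ℝ) [IsProbabilityMeasure ν] :
    IsProbabilityMeasure (sampleLaw d ν) := by
  unfold sampleLaw; infer_instance

instance (d m : ℕ) (ν : Measure ℝ) [IsProbabilityMeasure ν] :
    IsProbabilityMeasure (sourceLaw d m ν) := by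
  unfold sourceLaw; infer_instance

/-- Adds `⟨a, Δ⟩` to the noise of the triple `(a, ξ, τ)`. -/
def shiftNoise {d : ℕ} (Δ : EuclideanSpace ℝ (Fin d)) (p : EuclideanSpace ℝ (Fin d) × ℝ × ℝ) :
    EuclideanSpace ℝ (Fin d) × ℝ × ℝ :=
  (p.1, p.2.1 + ⟪p.1, Δ⟫, p.2.2)

/-- The density of the law of `shiftNoise Δ (a, ξ, τ)` with respect to that of `(a, ξ, τ)`. -/
def shiftDensity {d : ℕ} (Δ : EuclideanSpace ℝ (Fin d))
    (p : EuclideanSpace ℝ (Fin d) × ℝ × ℝ) : ℝ≥0∞ :=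
  ENNReal.ofReal (Real.exp (p.2.1 * ⟪p.1, Δ⟫ - ⟪p.1, Δ⟫ ^ 2 / 2))

theorem measurable_shiftNoise {d : ℕ} (Δ : EuclideanSpace ℝ (Fin d)) :
    Measurable (shiftNoise Δ) := by
  unfold shiftNoise; fun_prop

theorem measurable_shiftDensity {d : ℕ} (Δ : EuclideanSpace ℝ (Fin d)) :
    Measurable (shiftDensity Δ) := by
  unfold shiftDensity; fun_prop

theorem map_shiftNoise_sampleLaw {d : ℕ} (ν : Measure ℝ) [IsProbabilityMeasure ν]
    (Δ : EuclideanSpace ℝ (Fin d)) :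
    (sampleLaw d ν).map (shiftNoise Δ) = (sampleLaw d ν).withDensity (shiftDensity Δ) := by
  have hT := measurable_shiftNoise Δ
  have hD := measurable_shiftDensity Δ
  refine Measure.ext_of_lintegral _ fun f hf => ?_
  rw [lintegral_map hf hT, lintegral_withDensity_eq_lintegral_mul _ hD hf, sampleLaw,
    lintegral_prod (fun p => f (shiftNoise Δ p)) (hf.comp hT).aemeasurable,
    lintegral_prod _ (hD.mul hf).aemeasurable]
  refine lintegral_congr fun a => ?_
  have h1 : Measurable fun y : ℝ × ℝ => f (shiftNoise Δ (a, y)) := by fun_prop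
  have h2 : Measurable fun y : ℝ × ℝ => (shiftDensity Δ * f) (a, y) :=
    (hD.mul hf).comp measurable_prodMk_left
  rw [lintegral_prod _ h1.aemeasurable, lintegral_prod _ h2.aemeasurable]
  have h3 : Measurable fun y : ℝ × ℝ => f (a, y) := by fun_prop
  have h := lintegral_gaussianReal_add (f := fun x => ∫⁻ τ, f (a, x, τ) ∂ν)
    h3.lintegral_prod_right' ⟪a, Δ⟫
  refine h.trans (lintegral_congr fun x => ?_)
  exact (lintegral_const_mul _ (by fun_prop)).symm

theorem map_shiftNoise_sourceLaw {d : ℕ} (m : ℕ) (ν : Measure ℝ) [IsProbabilityMeasure ν]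
    (Δ : EuclideanSpace ℝ (Fin d)) :
    (sourceLaw d m ν).map (fun ω i => shiftNoise Δ (ω i)) =
      (sourceLaw d m ν).withDensity fun ω => ∏ i, shiftDensity Δ (ω i) := by
  have hm := map_shiftNoise_sampleLaw ν Δ
  have hp : IsProbabilityMeasure ((sampleLaw d ν).map (shiftNoise Δ)) :=
    Measure.isProbabilityMeasure_map (measurable_shiftNoise Δ).aemeasurable
  have hq : IsProbabilityMeasure ((sampleLaw d ν).withDensity (shiftDensity Δ)) := hm ▸ hp
  change (Measure.pi fun _ : Fin m => sampleLaw d ν).map _ =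
    (Measure.pi fun _ : Fin m => sampleLaw d ν).withDensity _
  rw [Measure.pi_map_pi fun _ => (measurable_shiftNoise Δ).aemeasurable, hm,
    pi_withDensity _ (measurable_shiftDensity Δ)]

theorem lintegral_eval_stdGaussian {d : ℕ} (p : Fin d) {f : ℝ → ℝ≥0∞} (hf : Measurable f) :
    ∫⁻ a, f (a p) ∂stdGaussian (EuclideanSpace ℝ (Fin d)) = ∫⁻ x, f x ∂gaussianReal 0 1 := by
  rw [← map_pi_eq_stdGaussian, lintegral_map (by fun_prop) (by fun_prop)]
  exact (measurePreserving_eval (fun _ : Fin d => gaussianReal 0 1) p).lintegral_comp hf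

theorem lintegral_shiftDensity_sq_le {d : ℕ} (ν : Measure ℝ) [IsProbabilityMeasure ν] (p : Fin d)
    {δ : ℝ} (hδ : δ ^ 2 ≤ 1 / 4) :
    ∫⁻ q, shiftDensity (δ • EuclideanSpace.single p (1 : ℝ)) q ^ 2 ∂sampleLaw d ν ≤
      ENNReal.ofReal (Real.exp (2 * δ ^ 2)) := by
  have hD := measurable_shiftDensity (δ • EuclideanSpace.single p (1 : ℝ))
  rw [sampleLaw, lintegral_prod _ (hD.pow_const 2).aemeasurable]
  refine le_trans (le_of_eq ?_) (lintegral_exp_sq_gaussianReal_le hδ)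
  rw [← lintegral_eval_stdGaussian p (by fun_prop)]
  refine lintegral_congr fun a => ?_
  have h2 : Measurable fun y : ℝ × ℝ =>
      shiftDensity (δ • EuclideanSpace.single p (1 : ℝ)) (a, y) ^ 2 :=
    (hD.pow_const 2).comp measurable_prodMk_left
  rw [lintegral_prod _ h2.aemeasurable]
  simp only [shiftDensity, lintegral_const, measure_univ, mul_one]
  rw [lintegral_likelihoodRatio_sq_gaussianReal]
  simp [inner_smul_right, EuclideanSpace.inner_single_right]

/-- The second moment of the likelihood ratio of the whole sample. The bound does not depend on the
dither law. -/
theorem lintegral_prod_shiftDensity_sq_le {d : ℕ} (m : ℕ) (ν : Measure ℝ) [IsProbabilityMeasure ν]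
    (p : Fin d) {δ : ℝ} (hδ : δ ^ 2 ≤ 1 / 4) :
    ∫⁻ ω, (∏ i, shiftDensity (δ • EuclideanSpace.single p (1 : ℝ)) (ω i)) ^ 2 ∂sourceLaw d m ν ≤
      ENNReal.ofReal (Real.exp (2 * m * δ ^ 2)) := by
  simp_rw [← Finset.prod_pow]
  refine (lintegral_pi_prod_eq_prod (sampleLaw d ν)
    (f := fun _ : Fin m => fun q => shiftDensity (δ • EuclideanSpace.single p (1 : ℝ)) q ^ 2)
    fun _ => (measurable_shiftDensity _).pow_const 2).trans_le ?_
  rw [Finset.prod_const, Finset.card_univ, Fintype.card_fin]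
  refine (pow_le_pow_left' (lintegral_shiftDensity_sq_le ν p hδ) m).trans (le_of_eq ?_)
  rw [← ENNReal.ofReal_pow (by positivity), ← Real.exp_nat_mul]
  congr 2
  ring

theorem measurable_observe_right {d : ℕ} (m : ℕ) (θ : EuclideanSpace ℝ (Fin d)) :
    Measurable (observe (m := m) θ) :=
  (measurable_observe d m).comp measurable_prodMk_left

/-- A change of the signal has the same effect on the quantized data as a change of the noise. -/
theorem observe_add {d m : ℕ} (θ Δ : EuclideanSpace ℝ (Fin d))
    (ω : Fin m → EuclideanSpace ℝ (Fin d) × ℝ × ℝ) :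
    observe (θ + Δ) ω = observe θ fun i => shiftNoise Δ (ω i) := by
  funext i
  simp only [observe, shiftNoise, inner_add_right]
  congr 2
  ring

theorem lintegral_observe_add {d m : ℕ} (ν : Measure ℝ) [IsProbabilityMeasure ν]
    (θ Δ : EuclideanSpace ℝ (Fin d)) {f : (Fin m → EuclideanSpace ℝ (Fin d) × ℝ) → ℝ≥0∞}
    (hf : Measurable f) :
    ∫⁻ ω, f (observe (θ + Δ) ω) ∂sourceLaw d m ν =
      ∫⁻ ω, (∏ i, shiftDensity Δ (ω i)) * f (observe θ ω) ∂sourceLaw d m ν := by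
  have hT : Measurable fun (ω : Fin m → EuclideanSpace ℝ (Fin d) × ℝ × ℝ) i =>
      shiftNoise Δ (ω i) :=
    measurable_pi_lambda _ fun i => (measurable_shiftNoise Δ).comp (measurable_pi_apply i)
  have hD : Measurable fun ω : Fin m → EuclideanSpace ℝ (Fin d) × ℝ × ℝ =>
      ∏ i, shiftDensity Δ (ω i) :=
    Finset.measurable_prod _ fun i _ => (measurable_shiftDensity Δ).comp (measurable_pi_apply i)
  have hg := hf.comp (measurable_observe_right m θ)
  simp_rw [observe_add]
  refine (lintegral_map hg hT).symm.trans ?_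
  rw [map_shiftNoise_sourceLaw, lintegral_withDensity_eq_lintegral_mul _ hD hg]
  rfl

/-- `2 L f ≤ s L ^ 2 + s⁻¹ f ^ 2` and `f ^ 2 ≤ f`. -/
theorem ENNReal.two_mul_mul_le_of_le_one {L f : ℝ≥0∞} (hL : L ≠ ∞) (hf : f ≤ 1) {s : ℝ}
    (hs : 0 < s) :
    2 * (L * f) ≤ ENNReal.ofReal s * L ^ 2 + ENNReal.ofReal s⁻¹ * f := by
  have hf' : f ≠ ∞ := ne_top_of_le_ne_top ENNReal.one_ne_top hf
  lift L to NNReal using hL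
  lift f to NNReal using hf'
  have hf1 : (f : ℝ) ≤ 1 := by exact_mod_cast hf
  have h0 : (0 : ℝ) ≤ f := f.2
  simp only [ENNReal.ofReal]
  norm_cast
  rw [← NNReal.coe_le_coe]
  push_cast [Real.coe_toNNReal _ hs.le, Real.coe_toNNReal _ (inv_nonneg.2 hs.le)]
  have h1 : s * (s⁻¹ * f) = f := by field_simp
  have h2 : 0 ≤ s⁻¹ * (s * L - f) ^ 2 := by positivity
  have h3 : s⁻¹ * (s * L - f) ^ 2 = s * L ^ 2 - 2 * (L * f) + s⁻¹ * (f * f) := by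
    field_simp
    ring
  have h4 : s⁻¹ * ((f : ℝ) * f) ≤ s⁻¹ * f := by
    refine mul_le_mul_of_nonneg_left ?_ (inv_nonneg.2 hs.le)
    nlinarith
  linarith

/-- A test that rarely accepts under the signal `θ` rarely accepts under `θ + δ e_p` either: the
Cauchy–Schwarz inequality for the likelihood ratio, in the form with a free parameter `s`. -/
theorem two_mul_lintegral_observe_add_single_le {d m : ℕ} (ν : Measure ℝ) [IsProbabilityMeasure ν]
    (θ : EuclideanSpace ℝ (Fin d)) (p : Fin d) {δ : ℝ} (hδ : δ ^ 2 ≤ 1 / 4)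
    {f : (Fin m → EuclideanSpace ℝ (Fin d) × ℝ) → ℝ≥0∞} (hf : Measurable f) (hf1 : ∀ z, f z ≤ 1)
    {s : ℝ} (hs : 0 < s) :
    2 * ∫⁻ ω, f (observe (θ + δ • EuclideanSpace.single p (1 : ℝ)) ω) ∂sourceLaw d m ν ≤
      ENNReal.ofReal s * ENNReal.ofReal (Real.exp (2 * m * δ ^ 2)) +
        ENNReal.ofReal s⁻¹ * ∫⁻ ω, f (observe θ ω) ∂sourceLaw d m ν := by
  set Δ := δ • EuclideanSpace.single p (1 : ℝ) with hΔ
  have hD : Measurable fun ω : Fin m → EuclideanSpace ℝ (Fin d) × ℝ × ℝ =>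
      ∏ i, shiftDensity Δ (ω i) :=
    Finset.measurable_prod _ fun i _ => (measurable_shiftDensity Δ).comp (measurable_pi_apply i)
  have hg : Measurable fun ω => f (observe θ ω) := hf.comp (measurable_observe_right m θ)
  rw [lintegral_observe_add ν θ Δ hf]
  refine (lintegral_const_mul _ (hD.mul hg)).symm.trans_le ?_
  calc ∫⁻ ω, 2 * ((∏ i, shiftDensity Δ (ω i)) * f (observe θ ω)) ∂sourceLaw d m ν
      ≤ ∫⁻ ω, (ENNReal.ofReal s * (∏ i, shiftDensity Δ (ω i)) ^ 2 +
          ENNReal.ofReal s⁻¹ * f (observe θ ω)) ∂sourceLaw d m ν :=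
        lintegral_mono fun ω => ENNReal.two_mul_mul_le_of_le_one
          (ENNReal.prod_ne_top fun i _ => ENNReal.ofReal_ne_top) (hf1 _) hs
    _ = ENNReal.ofReal s * ∫⁻ ω, (∏ i, shiftDensity Δ (ω i)) ^ 2 ∂sourceLaw d m ν +
          ENNReal.ofReal s⁻¹ * ∫⁻ ω, f (observe θ ω) ∂sourceLaw d m ν := by
        rw [lintegral_add_left ((hD.pow_const 2).const_mul _),
          lintegral_const_mul _ (hD.pow_const 2), lintegral_const_mul _ hg]
    _ ≤ _ := by
        gcongr
        exact lintegral_prod_shiftDensity_sq_le m ν p hδ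

/-! ### Block codes -/

/-- The signal that has the value `δ` in one entry of each of `k` blocks of `B` coordinates and
vanishes elsewhere: `e (j, i)` is the `i`-th coordinate of the block `j`, and `v j` is the position
of the nonzero entry in the block `j`. -/
def codeword {k B d : ℕ} (δ : ℝ) (e : Fin k × Fin B → Fin d) (v : Fin k → Fin B) :
    EuclideanSpace ℝ (Fin d) :=
  ∑ j, δ • EuclideanSpace.single (e (j, v j)) (1 : ℝ)

/-- The vectors whose unique largest entry in the block `j` is the `i`-th one. -/
def cell {k B d : ℕ} (e : Fin k × Fin B → Fin d) (j : Fin k) (i : Fin B) :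
    Set (EuclideanSpace ℝ (Fin d)) :=
  {t | ∀ i', i' ≠ i → t (e (j, i')) < t (e (j, i))}

theorem measurableSet_cell {k B d : ℕ} (e : Fin k × Fin B → Fin d) (j : Fin k) (i : Fin B) :
    MeasurableSet (cell e j i) := by
  have h : cell e j i = ⋂ i', ⋂ (_ : i' ≠ i), {t | t (e (j, i')) < t (e (j, i))} := by
    ext t; simp [cell]
  rw [h]
  exact MeasurableSet.iInter fun i' => MeasurableSet.iInter fun _ =>
    measurableSet_lt (by fun_prop) (by fun_prop)

theorem sum_measure_cell_le {k B d : ℕ} (e : Fin k × Fin B → Fin d) (j : Fin k)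
    (μ : Measure (EuclideanSpace ℝ (Fin d))) [IsProbabilityMeasure μ] :
    ∑ i, μ (cell e j i) ≤ 1 := by
  have hd : Pairwise fun i i' => Disjoint (cell e j i) (cell e j i') := fun i i' h =>
    Set.disjoint_left.2 fun t ht ht' => lt_asymm (ht i' h.symm) (ht' i h)
  rw [← tsum_fintype (L := .unconditional _),
    ← measure_iUnion hd fun i => measurableSet_cell e j i]
  exact prob_le_one

theorem codeword_apply {k B d : ℕ} (δ : ℝ) (e : Fin k × Fin B → Fin d) (v : Fin k → Fin B)
    (p : Fin d) : codeword δ e v p = ∑ j, if e (j, v j) = p then δ else 0 := by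
  simp [codeword, Pi.single_apply, eq_comm]

theorem codeword_apply_coord {k B d : ℕ} (δ : ℝ) {e : Fin k × Fin B → Fin d}
    (he : Function.Injective e) (v : Fin k → Fin B) (j : Fin k) (i : Fin B) :
    codeword δ e v (e (j, i)) = if v j = i then δ else 0 := by
  rw [codeword_apply, Finset.sum_eq_single j]
  · simp [he.eq_iff]
  · intro j' _ hj
    simp [he.eq_iff, hj]
  · simp

theorem codeword_update {k B d : ℕ} (δ : ℝ) (e : Fin k × Fin B → Fin d) (v : Fin k → Fin B)
    (j : Fin k) (i : Fin B) :
    codeword δ e (Function.update v j i) =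
      (∑ j' ∈ Finset.univ.erase j, δ • EuclideanSpace.single (e (j', v j')) (1 : ℝ)) +
        δ • EuclideanSpace.single (e (j, i)) (1 : ℝ) := by
  rw [codeword, ← Finset.sum_erase_add _ _ (Finset.mem_univ j), Function.update_self]
  congr 1
  refine Finset.sum_congr rfl fun j' hj => ?_
  rw [Function.update_of_ne (Finset.ne_of_mem_erase hj)]

theorem norm_codeword_sq {k B d : ℕ} (δ : ℝ) {e : Fin k × Fin B → Fin d}
    (he : Function.Injective e) (v : Fin k → Fin B) : ‖codeword δ e v‖ ^ 2 = k * δ ^ 2 := by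
  rw [← real_inner_self_eq_norm_sq]
  nth_rewrite 1 [codeword]
  simp [sum_inner, inner_smul_left, EuclideanSpace.inner_single_left, codeword_apply_coord δ he, sq]

/-- Every block in which `t` does not point to the nonzero entry of the codeword contributes at
least `δ ^ 2 / 4` to the squared distance between `t` and the codeword. -/
theorem card_mul_le_norm_sub_codeword_sq {k B d : ℕ} {δ : ℝ} (hδ : 0 ≤ δ) {e : Fin k × Fin B → Fin d}
    (he : Function.Injective e) (v : Fin k → Fin B) (t : EuclideanSpace ℝ (Fin d))
    {s : Finset (Fin k)} (hs : ∀ j ∈ s, t ∉ cell e j (v j)) :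
    s.card * (δ ^ 2 / 4) ≤ ‖t - codeword δ e v‖ ^ 2 := by
  set x := t - codeword δ e v with hx
  calc s.card * (δ ^ 2 / 4) = ∑ j ∈ s, δ ^ 2 / 4 := by rw [Finset.sum_const, nsmul_eq_mul]
    _ ≤ ∑ j ∈ s, ∑ i, x (e (j, i)) ^ 2 := by
        refine Finset.sum_le_sum fun j hj => ?_
        have h := hs j hj
        simp only [cell, Set.mem_ofPred_eq, not_forall, not_lt] at h
        obtain ⟨i, hi, hti⟩ := h
        have h1 : x (e (j, v j)) = t (e (j, v j)) - δ := by
          simp [hx, codeword_apply_coord δ he]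
        have h2 : x (e (j, i)) = t (e (j, i)) := by
          simp [hx, codeword_apply_coord δ he, Ne.symm hi]
        have h3 := Finset.add_le_sum (f := fun i => x (e (j, i)) ^ 2) (s := Finset.univ)
          (fun i _ => sq_nonneg _) (Finset.mem_univ i) (Finset.mem_univ (v j)) hi
        refine le_trans ?_ h3
        simp only [h1, h2]
        nlinarith [sq_nonneg (t (e (j, i)) + t (e (j, v j)) - δ),
          sq_nonneg (t (e (j, i)) - t (e (j, v j)) + δ),
          sq_nonneg (t (e (j, i)) - t (e (j, v j)))]
    _ ≤ ∑ j, ∑ i, x (e (j, i)) ^ 2 :=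
        Finset.sum_le_sum_of_subset_of_nonneg (Finset.subset_univ _) fun j _ _ =>
          Finset.sum_nonneg fun i _ => sq_nonneg _
    _ = ∑ p ∈ Finset.univ.image e, x p ^ 2 := by
        rw [Finset.sum_image he.injOn, Fintype.sum_prod_type]
    _ ≤ ∑ p, x p ^ 2 :=
        Finset.sum_le_sum_of_subset_of_nonneg (Finset.subset_univ _) fun p _ _ => sq_nonneg _
    _ = ‖x‖ ^ 2 := (EuclideanSpace.real_norm_sq_eq x).symm

/-- The loss is at least a multiple of the number of blocks that are decoded wrongly. This form
linearizes the distance: the number `N ≤ k` of wrong blocks satisfies `√N ≥ N / √k`. -/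
theorem le_norm_sub_codeword_add_indicator {k B d : ℕ} {δ : ℝ} (hδ : 0 ≤ δ)
    {e : Fin k × Fin B → Fin d} (he : Function.Injective e) (v : Fin k → Fin B)
    (t : EuclideanSpace ℝ (Fin d)) :
    ENNReal.ofReal (δ / (2 * √k)) * k ≤ ENNReal.ofReal ‖t - codeword δ e v‖ +
      ENNReal.ofReal (δ / (2 * √k)) * ∑ j, (cell e j (v j)).indicator 1 t := by
  classical
  set c := δ / (2 * √k) with hc
  have hc0 : 0 ≤ c := by positivity
  set s : Finset (Fin k) := Finset.univ.filter fun j => t ∉ cell e j (v j) with hs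
  have h1 : ∑ j, (cell e j (v j)).indicator (1 : EuclideanSpace ℝ (Fin d) → ℝ≥0∞) t =
      ((Finset.univ.filter fun j => t ∈ cell e j (v j)).card : ℝ≥0∞) := by
    simp [Set.indicator_apply, Finset.sum_boole]
  have h2 : (Finset.univ.filter fun j => t ∈ cell e j (v j)).card + s.card = k := by
    simpa using Finset.card_filter_add_card_filter_not (s := (Finset.univ : Finset (Fin k)))
      (fun j => t ∈ cell e j (v j))
  have h3 : c * s.card ≤ ‖t - codeword δ e v‖ := by
    refine le_of_sq_le_sq ?_ (norm_nonneg _)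
    refine le_trans ?_ (card_mul_le_norm_sub_codeword_sq hδ he v t (s := s) (by simp [hs]))
    have hsk : (s.card : ℝ) ≤ k := by exact_mod_cast (by omega : s.card ≤ k)
    rcases Nat.eq_zero_or_pos k with hk | hk
    · have h0 : (s.card : ℝ) = 0 := by exact_mod_cast (by omega : s.card = 0)
      simp [h0]
    have hk' : (0 : ℝ) < k := by exact_mod_cast hk
    have h4 : (c * s.card) ^ 2 = s.card * (δ ^ 2 / 4) * (s.card / k) := by
      rw [hc, mul_pow, div_pow, mul_pow, Real.sq_sqrt hk'.le]
      field_simp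
      ring
    rw [h4]
    exact mul_le_of_le_one_right (by positivity) ((div_le_one hk').2 hsk)
  have h5 : (k : ℝ≥0∞) = (Finset.univ.filter fun j => t ∈ cell e j (v j)).card + s.card := by
    exact_mod_cast h2.symm
  rw [h1, h5, mul_add, add_comm]
  gcongr
  calc ENNReal.ofReal c * (s.card : ℝ≥0∞) = ENNReal.ofReal (c * s.card) := by
        rw [ENNReal.ofReal_mul hc0, ENNReal.ofReal_natCast]
    _ ≤ _ := ENNReal.ofReal_le_ofReal h3

/-! ### The minimax bound -/

theorem lintegral_oneBitExperiment {d m : ℕ} (K : Set (EuclideanSpace ℝ (Fin d))) (ν : Measure ℝ)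
    [IsProbabilityMeasure ν] (θ : K) {f : (Fin m → EuclideanSpace ℝ (Fin d) × ℝ) → ℝ≥0∞}
    (hf : Measurable f) :
    ∫⁻ z, f z ∂oneBitExperiment K m ν θ = ∫⁻ ω, f (observe θ.1 ω) ∂sourceLaw d m ν :=
  lintegral_map hf (measurable_observe_right m θ.1)

/-- When the other blocks are known, the average over the `B` candidates of the probability of
decoding the block `j` correctly is at most `7 / 8`. -/
theorem sum_lintegral_cell_le {k B d m : ℕ} (hB : 1 ≤ B) (ν : Measure ℝ) [IsProbabilityMeasure ν]
    {δ : ℝ} (hδ : δ ^ 2 ≤ 1 / 4) (hM : Real.exp (2 * m * δ ^ 2) ≤ 3 / 4 * B)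
    (e : Fin k × Fin B → Fin d)
    (κ : Kernel (Fin m → EuclideanSpace ℝ (Fin d) × ℝ) (EuclideanSpace ℝ (Fin d)))
    [IsMarkovKernel κ] (v : Fin k → Fin B) (j : Fin k) :
    ∑ i, ∫⁻ ω, κ (observe (codeword δ e (Function.update v j i)) ω) (cell e j i) ∂sourceLaw d m ν ≤
      ENNReal.ofReal (7 / 8 * B) := by
  have hB' : (0 : ℝ) < B := by exact_mod_cast hB
  set θ := ∑ j' ∈ Finset.univ.erase j, δ • EuclideanSpace.single (e (j', v j')) (1 : ℝ)
  have hκ : ∀ i, Measurable fun z => κ z (cell e j i) :=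
    fun i => Kernel.measurable_coe κ (measurableSet_cell e j i)
  -- The parameter `6 / (5 B)` nearly minimizes `s * (3 / 4 * B) * B + 1 / s`.
  have hs : (0 : ℝ) < 6 / (5 * B) := by positivity
  have hQ : ∑ i, ∫⁻ ω, κ (observe θ ω) (cell e j i) ∂sourceLaw d m ν ≤ 1 := by
    refine (lintegral_finsetSum _ fun i _ =>
      (hκ i).comp (measurable_observe_right m θ)).symm.trans_le ?_
    refine (lintegral_mono fun ω => sum_measure_cell_le e j _).trans ?_
    simp
  have h2 : 2 * ∑ i, ∫⁻ ω, κ (observe (codeword δ e (Function.update v j i)) ω) (cell e j i)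
      ∂sourceLaw d m ν ≤ 2 * ENNReal.ofReal (7 / 8 * B) := by
    calc 2 * ∑ i, ∫⁻ ω, κ (observe (codeword δ e (Function.update v j i)) ω) (cell e j i)
          ∂sourceLaw d m ν
        ≤ ∑ i, (ENNReal.ofReal (6 / (5 * B)) * ENNReal.ofReal (Real.exp (2 * m * δ ^ 2)) +
            ENNReal.ofReal (6 / (5 * B))⁻¹ *
              ∫⁻ ω, κ (observe θ ω) (cell e j i) ∂sourceLaw d m ν) := by
          rw [Finset.mul_sum]
          refine Finset.sum_le_sum fun i _ => ?_
          rw [codeword_update]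
          exact two_mul_lintegral_observe_add_single_le ν θ (e (j, i)) hδ (hκ i)
            (fun z => prob_le_one) hs
      _ ≤ B * (ENNReal.ofReal (6 / (5 * B)) * ENNReal.ofReal (3 / 4 * B)) +
            ENNReal.ofReal (6 / (5 * B))⁻¹ * 1 := by
          rw [Finset.sum_add_distrib, ← Finset.mul_sum (f := fun i => ∫⁻ ω, κ (observe θ ω)
            (cell e j i) ∂sourceLaw d m ν), Finset.sum_const, Finset.card_univ,
            Fintype.card_fin, nsmul_eq_mul]
          gcongr
      _ ≤ 2 * ENNReal.ofReal (7 / 8 * B) := by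
          rw [← ENNReal.ofReal_natCast, ← ENNReal.ofReal_ofNat, mul_one,
            ← ENNReal.ofReal_mul (by positivity), ← ENNReal.ofReal_mul (by positivity),
            ← ENNReal.ofReal_mul (by positivity), ← ENNReal.ofReal_add (by positivity)
            (by positivity)]
          refine ENNReal.ofReal_le_ofReal ?_
          have : (B : ℝ) * (6 / (5 * B) * (3 / 4 * B)) + (6 / (5 * (B : ℝ)))⁻¹ = 26 / 15 * B := by
            field_simp
            ring
          rw [this]
          linarith
  exact (ENNReal.mul_le_mul_iff_right two_ne_zero ENNReal.ofNat_ne_top).1 h2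

/-- The map `(v, i) ↦ (update v j i, v j)` is an involution, so summing over both arguments counts
every `v` exactly `B` times. -/
theorem sum_sum_update {k B : ℕ} (j : Fin k) (F : (Fin k → Fin B) → ℝ≥0∞) :
    ∑ v, ∑ i, F (Function.update v j i) = B * ∑ v, F v := by
  have hinv : Function.Involutive fun p : (Fin k → Fin B) × Fin B =>
      (Function.update p.1 j p.2, p.1 j) := fun p => by simp
  rw [← Fintype.sum_prod_type']
  refine (Equiv.sum_comp hinv.toPerm fun p => F p.1).trans ?_
  rw [Fintype.sum_prod_type]
  simp [Finset.mul_sum]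

theorem sum_lintegral_cell_le_card {k B d m : ℕ} (hB : 1 ≤ B) (ν : Measure ℝ)
    [IsProbabilityMeasure ν] {δ : ℝ} (hδ : δ ^ 2 ≤ 1 / 4)
    (hM : Real.exp (2 * m * δ ^ 2) ≤ 3 / 4 * B) (e : Fin k × Fin B → Fin d)
    (κ : Kernel (Fin m → EuclideanSpace ℝ (Fin d) × ℝ) (EuclideanSpace ℝ (Fin d)))
    [IsMarkovKernel κ] (j : Fin k) :
    ∑ v, ∫⁻ ω, κ (observe (codeword δ e v) ω) (cell e j (v j)) ∂sourceLaw d m ν ≤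
      Fintype.card (Fin k → Fin B) * ENNReal.ofReal (7 / 8) := by
  have hB0 : (B : ℝ≥0∞) ≠ 0 := by exact_mod_cast (by omega : B ≠ 0)
  rw [← ENNReal.mul_le_mul_iff_right hB0 (ENNReal.natCast_ne_top B), ← sum_sum_update j]
  simp only [Function.update_self]
  refine (Finset.sum_le_sum fun v _ => sum_lintegral_cell_le hB ν hδ hM e κ v j).trans
    (le_of_eq ?_)
  rw [Finset.sum_const, Finset.card_univ, nsmul_eq_mul, ENNReal.ofReal_mul (by norm_num),
    ENNReal.ofReal_natCast]
  ring

/-- Averaging the risk over all codewords: the blocks contribute equally, and each of them is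
decoded wrongly with average probability at least `1 / 8`. -/
theorem le_oneBitMinimaxRisk_of_codeword_mem {k B d m : ℕ} (hk : 1 ≤ k) (hB : 1 ≤ B)
    (ν : Measure ℝ) [IsProbabilityMeasure ν] {δ : ℝ} (hδ0 : 0 ≤ δ) (hδ : δ ^ 2 ≤ 1 / 4)
    (hM : Real.exp (2 * m * δ ^ 2) ≤ 3 / 4 * B) {e : Fin k × Fin B → Fin d}
    (he : Function.Injective e) {K : Set (EuclideanSpace ℝ (Fin d))}
    (hK : ∀ v, codeword δ e v ∈ K) :
    ENNReal.ofReal (δ * √k / 16) ≤ oneBitMinimaxRisk K m ν := by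
  unfold oneBitMinimaxRisk minimaxRisk
  refine le_iInf₂ fun κ hκ => ?_
  set R := ⨆ θ : K, ∫⁻ y, ENNReal.ofReal ‖y - θ.1‖ ∂(κ ∘ₖ oneBitExperiment K m ν) θ with hR
  have hk0 : (0 : ℝ) < k := by exact_mod_cast hk
  set c := δ / (2 * √k) with hc
  have hc0 : 0 ≤ c := by positivity
  set F : Fin k → (Fin k → Fin B) → ℝ≥0∞ := fun j v =>
    ∫⁻ ω, κ (observe (codeword δ e v) ω) (cell e j (v j)) ∂sourceLaw d m ν with hF
  have hprob : ∀ v, IsProbabilityMeasure ((κ ∘ₖ oneBitExperiment K m ν) ⟨_, hK v⟩) := by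
    intro v
    have : IsProbabilityMeasure (oneBitExperiment K m ν ⟨_, hK v⟩) :=
      Measure.isProbabilityMeasure_map (measurable_observe_right m _).aemeasurable
    rw [Kernel.comp_apply]
    infer_instance
  have hrisk : ∀ v, ENNReal.ofReal c * k ≤ R + ENNReal.ofReal c * ∑ j, F j v := by
    intro v
    have := hprob v
    set μ := (κ ∘ₖ oneBitExperiment K m ν) ⟨_, hK v⟩ with hμ
    have hFμ : ∀ j, F j v = μ (cell e j (v j)) := fun j => by
      rw [hμ, Kernel.comp_apply' _ _ _ (measurableSet_cell e j (v j)),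
        lintegral_oneBitExperiment K ν _ (Kernel.measurable_coe κ (measurableSet_cell e j (v j)))]
    have hm : ∀ j ∈ Finset.univ, Measurable ((cell e j (v j)).indicator
        (1 : EuclideanSpace ℝ (Fin d) → ℝ≥0∞)) := fun j _ =>
      measurable_one.indicator (measurableSet_cell e j (v j))
    calc ENNReal.ofReal c * k = ∫⁻ _, ENNReal.ofReal c * k ∂μ := by simp
      _ ≤ ∫⁻ t, (ENNReal.ofReal ‖t - codeword δ e v‖ +
            ENNReal.ofReal c * ∑ j, (cell e j (v j)).indicator 1 t) ∂μ :=
          lintegral_mono fun t => le_norm_sub_codeword_add_indicator hδ0 he v t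
      _ = ∫⁻ t, ENNReal.ofReal ‖t - codeword δ e v‖ ∂μ + ENNReal.ofReal c * ∑ j, F j v := by
          rw [lintegral_add_left (by fun_prop), lintegral_const_mul _
            (Finset.measurable_fun_sum _ hm), lintegral_finsetSum _ hm]
          simp_rw [hFμ, lintegral_indicator_one (measurableSet_cell e _ _)]
      _ ≤ _ := by
          gcongr
          exact le_iSup (fun θ : K => ∫⁻ y, ENNReal.ofReal ‖y - θ.1‖
            ∂(κ ∘ₖ oneBitExperiment K m ν) θ) ⟨_, hK v⟩
  set n := Fintype.card (Fin k → Fin B) with hn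
  have : Nonempty (Fin B) := ⟨⟨0, hB⟩⟩
  have hn0 : (n : ℝ≥0∞) ≠ 0 := by exact_mod_cast Fintype.card_ne_zero
  have hsum : n * (ENNReal.ofReal c * k) ≤
      n * (R + ENNReal.ofReal c * (k * ENNReal.ofReal (7 / 8))) := by
    calc n * (ENNReal.ofReal c * k) = ∑ _v : Fin k → Fin B, ENNReal.ofReal c * (k : ℝ≥0∞) := by
          rw [Finset.sum_const, Finset.card_univ, nsmul_eq_mul]
      _ ≤ ∑ v, (R + ENNReal.ofReal c * ∑ j, F j v) := Finset.sum_le_sum fun v _ => hrisk v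
      _ = n * R + ENNReal.ofReal c * ∑ j, ∑ v, F j v := by
          rw [Finset.sum_add_distrib, ← Finset.mul_sum, Finset.sum_comm, Finset.sum_const,
            Finset.card_univ, nsmul_eq_mul]
      _ ≤ n * R + ENNReal.ofReal c * ∑ _j : Fin k, n * ENNReal.ofReal (7 / 8) := by
          gcongr with j
          exact sum_lintegral_cell_le_card hB ν hδ hM e κ j
      _ = _ := by
          rw [Finset.sum_const, Finset.card_univ, Fintype.card_fin, nsmul_eq_mul]
          ring
  have h := (ENNReal.mul_le_mul_iff_right hn0 (ENNReal.natCast_ne_top n)).1 hsum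
  have h1 : ENNReal.ofReal c * k = ENNReal.ofReal (δ * √k / 16) +
      ENNReal.ofReal c * (k * ENNReal.ofReal (7 / 8)) := by
    rw [← ENNReal.ofReal_natCast, ← ENNReal.ofReal_mul hc0, ← ENNReal.ofReal_mul (by positivity),
      ← ENNReal.ofReal_mul hc0, ← ENNReal.ofReal_add (by positivity) (by positivity)]
    congr 1
    have hsq : √(k : ℝ) * √k = k := Real.mul_self_sqrt hk0.le
    have hs0 : (0 : ℝ) < √k := Real.sqrt_pos.2 hk0
    have hck : c * k = δ * √k / 2 := by
      rw [hc, ← hsq, Real.sqrt_mul_self hs0.le]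
      field_simp
    linarith
  rw [h1] at h
  exact ENNReal.le_of_add_le_add_right (ENNReal.mul_ne_top ENNReal.ofReal_ne_top
    (ENNReal.mul_ne_top (ENNReal.natCast_ne_top k) ENNReal.ofReal_ne_top)) h

/-! ### The generative network -/

/-- The coordinate of `ℝ^d` that belongs to the `i`-th entry of the block `j`. -/
def blockCoord {k B d : ℕ} (h : k * B ≤ d) (p : Fin k × Fin B) : Fin d :=
  Fin.castLE h (finProdFinEquiv p)

theorem blockCoord_injective {k B d : ℕ} (h : k * B ≤ d) :
    Function.Injective (blockCoord h : Fin k × Fin B → Fin d) :=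
  (Fin.castLE_injective h).comp finProdFinEquiv.injective

/-- The network that turns the input `(s, x₁, …, x_k)` into `k` blocks of `B` entries. The first
layer computes `(x_j - l s)₊` for `l < B + 2`, the second one the second differences of these in
`l`, which are hat functions of `x_j` with nodes `s, 2 s, …, B s`, and the third one puts the
blocks into `ℝ^d`. -/
def hatNet {k B d : ℕ} (h : k * B ≤ d) : ReLUNet 3 (k + 1) d :=
  (((ReLUNet.input (k + 1)).layer
    (Matrix.of fun q : Fin (k * (B + 2)) =>
      Pi.single (finProdFinEquiv.symm q).1.succ (1 : ℝ) -
        Pi.single 0 (((finProdFinEquiv.symm q).2 : ℕ) : ℝ))).layer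
    (Matrix.of fun q : Fin (k * B) =>
      let j := (finProdFinEquiv.symm q).1
      let i := (finProdFinEquiv.symm q).2
      Pi.single (finProdFinEquiv (j, (i.castAdd 2))) (1 : ℝ) -
        Pi.single (finProdFinEquiv (j, i.succ.castSucc)) (2 : ℝ) +
        Pi.single (finProdFinEquiv (j, i.succ.succ)) (1 : ℝ))).layer
    (Matrix.of fun p q => if Fin.castLE h q = p then (1 : ℝ) else 0)

theorem hatNet_widthLE {k B d : ℕ} (h : k * B ≤ d) (h' : k * (B + 2) ≤ d) :
    (hatNet h).WidthLE d := by
  simp [hatNet, ReLUNet.WidthLE, h, h']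

/-- The hat function with node `i + 1`, scaled by `δ`, at the point `(n + 1) δ`. -/
theorem relu_secondDifference (n i : ℕ) {δ : ℝ} (hδ : 0 ≤ δ) :
    max (max ((n + 1) * δ - i * δ) 0 - 2 * max ((n + 1) * δ - (i + 1) * δ) 0 +
      max ((n + 1) * δ - (i + 1 + 1) * δ) 0) 0 = if n = i then δ else 0 := by
  rcases lt_trichotomy n i with hn | rfl | hn
  · have hn' : (n : ℝ) + 1 ≤ i := by exact_mod_cast hn
    rw [max_eq_right (a := (n + 1) * δ - i * δ) (by nlinarith),
      max_eq_right (a := (n + 1) * δ - (i + 1) * δ) (by nlinarith),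
      max_eq_right (a := (n + 1) * δ - (i + 1 + 1) * δ) (by nlinarith), if_neg hn.ne]
    simp
  · rw [max_eq_left (a := (n + 1) * δ - n * δ) (by nlinarith),
      max_eq_right (a := (n + 1) * δ - (n + 1) * δ) (by nlinarith),
      max_eq_right (a := (n + 1) * δ - (n + 1 + 1) * δ) (by nlinarith), if_pos rfl,
      max_eq_left (by nlinarith)]
    ring
  · have hn' : (i : ℝ) + 1 ≤ n := by exact_mod_cast hn
    rw [max_eq_left (a := (n + 1) * δ - i * δ) (by nlinarith),
      max_eq_left (a := (n + 1) * δ - (i + 1) * δ) (by nlinarith),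
      max_eq_left (a := (n + 1) * δ - (i + 1 + 1) * δ) (by nlinarith), if_neg hn.ne',
      max_eq_right (by nlinarith)]

theorem hatNet_eval {k B d : ℕ} (h : k * B ≤ d) {δ : ℝ} (hδ : 0 ≤ δ) (v : Fin k → Fin B) :
    (hatNet h).eval (WithLp.toLp 2 (Fin.cons δ fun j => (((v j : ℕ) : ℝ) + 1) * δ)) =
      codeword δ (blockCoord h) v := by
  ext p
  rw [codeword_apply]
  simp only [hatNet, ReLUNet.eval]
  have hW : ∀ u : Fin k × Fin B → ℝ, (Matrix.of (fun (p : Fin d) q =>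
      if Fin.castLE h q = p then (1 : ℝ) else 0) *ᵥ fun q => u (finProdFinEquiv.symm q)) p =
      ∑ j, ∑ i, if blockCoord h (j, i) = p then u (j, i) else 0 := by
    intro u
    rw [← Fintype.sum_prod_type (f := fun a : Fin k × Fin B =>
      if blockCoord h a = p then u a else 0), ← finProdFinEquiv.symm.sum_comp]
    simp only [Matrix.mulVec, dotProduct, blockCoord, Equiv.apply_symm_apply, Matrix.of_apply,
      ite_mul, one_mul, zero_mul]
  have hu : ∀ (j : Fin k) (i : Fin B), max (max ((((v j : ℕ) : ℝ) + 1) * δ - (i : ℕ) * δ) 0 -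
      2 * max ((((v j : ℕ) : ℝ) + 1) * δ - ((i : ℕ) + 1) * δ) 0 +
      max ((((v j : ℕ) : ℝ) + 1) * δ - ((i : ℕ) + 1 + 1) * δ) 0) 0 =
      if v j = i then δ else 0 := fun j i => by
    rw [relu_secondDifference _ _ hδ]
    simp [Fin.ext_iff]
  have hsum := hW fun a => if v a.1 = a.2 then δ else 0
  have hsum' : (∑ j, ∑ i, if blockCoord h (j, i) = p then (if v j = i then δ else 0) else 0) =
      ∑ j, if blockCoord h (j, v j) = p then δ else 0 := by
    refine Finset.sum_congr rfl fun j _ => ?_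
    rw [Finset.sum_eq_single (v j)]
    · simp
    · intro i _ hi
      simp [Ne.symm hi]
    · simp
  have hnn : 0 ≤ ∑ j, if blockCoord h (j, v j) = p then δ else 0 :=
    Finset.sum_nonneg fun j _ => by split_ifs <;> simp [hδ]
  rw [← max_eq_left hnn, ← hsum', ← hsum]
  congr 2
  funext q
  rw [← hu]
  simp only [Equiv.symm_apply_apply, Matrix.mulVec, Matrix.of_apply, add_dotProduct,
    sub_dotProduct, single_dotProduct]
  simp

/-! ### The lower bound for the network -/

/-- Replacing `d / k` by the number of hats in a block costs a constant factor: if `B + 2` is the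
integer part of `d / k`, then `d / k ≤ B + 3 ≤ B ^ 3`. -/
theorem log_div_le_three_mul_log {k d : ℕ} (hk : 1 ≤ k) (hd : 4 * k ≤ d) :
    Real.log (d / k) ≤ 3 * Real.log ((d / k - 2 : ℕ) : ℝ) := by
  have hk0 : (0 : ℝ) < k := by exact_mod_cast hk
  have hd0 : (0 : ℝ) < d := by exact_mod_cast (by omega : 0 < d)
  have h4 : 4 ≤ d / k := (Nat.le_div_iff_mul_le hk).2 hd
  have h1 : d ≤ k * (d / k + 1) := (Nat.lt_mul_div_succ d hk).le
  obtain ⟨B, hB⟩ : ∃ B, d / k = B + 2 := ⟨d / k - 2, by omega⟩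
  have hB2 : (2 : ℝ) ≤ B := by exact_mod_cast (by omega : 2 ≤ B)
  rw [hB] at h1
  rw [hB, Nat.add_sub_cancel]
  have h2 : (d : ℝ) / k ≤ (B : ℝ) ^ 3 := by
    rw [div_le_iff₀ hk0]
    have h3 : (d : ℝ) ≤ k * (B + 2 + 1) := by exact_mod_cast h1
    refine h3.trans ?_
    rw [mul_comm]
    refine mul_le_mul_of_nonneg_right ?_ hk0.le
    nlinarith [mul_nonneg (sub_nonneg.2 hB2) (sub_nonneg.2 hB2),
      mul_nonneg (mul_nonneg (sub_nonneg.2 hB2) (sub_nonneg.2 hB2)) (by linarith : (0 : ℝ) ≤ B)]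
  calc Real.log (d / k) ≤ Real.log ((B : ℝ) ^ 3) := Real.log_le_log (by positivity) h2
    _ = 3 * Real.log B := by rw [Real.log_pow]; norm_num

theorem le_oneBitMinimaxRisk_hatNet {k d m : ℕ} (hk : 1 ≤ k) (hd : 4 * k ≤ d)
    (h : k * (d / k - 2) ≤ d) (ν : Measure ℝ) [IsProbabilityMeasure ν] {δ : ℝ} (hδ0 : 0 ≤ δ)
    (hδ : k * δ ^ 2 ≤ 1 / 4) (hm : 12 * (m * δ ^ 2) ≤ Real.log (d / k)) :
    ENNReal.ofReal (δ * √k / 16) ≤ oneBitMinimaxRisk (hatNet h).signals m ν := by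
  have h4 : 4 ≤ d / k := (Nat.le_div_iff_mul_le hk).2 hd
  have hlog := log_div_le_three_mul_log hk hd
  set B := d / k - 2 with hBdef
  have hB2 : (2 : ℝ) ≤ B := by exact_mod_cast (by omega : 2 ≤ B)
  have hk1 : (1 : ℝ) ≤ k := by exact_mod_cast hk
  refine le_oneBitMinimaxRisk_of_codeword_mem hk (by omega) ν hδ0 ?_ ?_ (blockCoord_injective h) ?_
  · nlinarith [sq_nonneg δ]
  · calc Real.exp (2 * m * δ ^ 2) ≤ Real.exp (Real.log B / 2) := by
          rw [Real.exp_le_exp]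
          linarith
      _ = √(B : ℝ) := by
          rw [← Real.log_sqrt (by linarith), Real.exp_log (Real.sqrt_pos.2 (by linarith))]
      _ ≤ 3 / 4 * B := Real.sqrt_le_iff.2 ⟨by linarith, by nlinarith⟩
  · refine fun v => ⟨⟨_, hatNet_eval h hδ0 v⟩, ?_⟩
    rw [mem_closedBall_zero_iff, ← sq_le_one_iff₀ (norm_nonneg _),
      norm_codeword_sq δ (blockCoord_injective h)]
    linarith

end

theorem mainTheorem3 :
    ∃ c₁ c₂ c₃ ε₀ : ℝ, 0 < c₁ ∧ 0 < c₂ ∧ 0 < c₃ ∧ 0 < ε₀ ∧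
      ∀ k d : ℕ, 1 ≤ k → 4 * k ≤ d →
        ∃ G : ReLUNet 3 (k + 1) d, G.WidthLE d ∧
          ∀ (ν : Measure ℝ) [IsProbabilityMeasure ν] (m : ℕ),
            (c₁ * (k * Real.log (d / k)) ≤ m →
              ENNReal.ofReal (c₂ * √(k * Real.log (d / k) / m)) ≤ oneBitMinimaxRisk G.signals m ν) ∧
            (∀ ε : ℝ, 0 < ε → ε ≤ ε₀ → oneBitMinimaxRisk G.signals m ν ≤ ENNReal.ofReal ε →
              c₃ * (k * Real.log (d / k) / ε ^ 2) ≤ m) := by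
  refine ⟨1, 1 / 64, 1 / 12288, 1 / 64, by norm_num, by norm_num, by norm_num, by norm_num,
    fun k d hk hd => ?_⟩
  have h4 : 4 ≤ d / k := (Nat.le_div_iff_mul_le hk).2 hd
  have hle : k * (d / k - 2 + 2) ≤ d := by
    rw [Nat.sub_add_cancel (by omega)]
    exact Nat.mul_div_le d k
  have hle' : k * (d / k - 2) ≤ d := le_trans (Nat.mul_le_mul_left k (by omega)) hle
  have hk0 : (0 : ℝ) < k := by exact_mod_cast hk
  have hlog : 0 < Real.log (d / k) := by
    refine Real.log_pos ((one_lt_div hk0).2 ?_)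
    exact_mod_cast (by omega : k < d)
  refine ⟨hatNet hle', hatNet_widthLE hle' hle, fun ν _ m => ⟨fun hm => ?_, fun ε hε hε' hR => ?_⟩⟩
  · have hm0 : (0 : ℝ) < m := lt_of_lt_of_le (by positivity) hm
    have hδ2 : √(Real.log (d / k) / (12 * m)) ^ 2 = Real.log (d / k) / (12 * m) :=
      Real.sq_sqrt (by positivity)
    refine le_trans (ENNReal.ofReal_le_ofReal ?_) (le_oneBitMinimaxRisk_hatNet hk hd hle' ν
      (δ := √(Real.log (d / k) / (12 * m))) (by positivity) ?_ ?_)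
    · have h12 : √(12 : ℝ) ≤ 4 := Real.sqrt_le_iff.2 ⟨by norm_num, by norm_num⟩
      have e : √(k * Real.log (d / k) / m) =
          √(12 : ℝ) * (√(Real.log (d / k) / (12 * m)) * √k) := by
        rw [← Real.sqrt_mul (by positivity), ← Real.sqrt_mul (by positivity)]
        congr 1
        field_simp
      rw [e]
      have := mul_le_mul_of_nonneg_right h12
        (by positivity : 0 ≤ √(Real.log (d / k) / (12 * m)) * √k)
      linarith
    · rw [hδ2, mul_div_assoc', div_le_iff₀ (by positivity)]
      linarith
    · rw [hδ2]
      refine le_of_eq ?_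
      field_simp
  · by_contra! hlt
    -- With `δ = 32 ε / √k` the lower bound for the risk is `2 ε`.
    have hδ2 : (32 * ε / √k) ^ 2 = 1024 * ε ^ 2 / k := by
      rw [div_pow, Real.sq_sqrt hk0.le]
      ring
    have hle2 := le_oneBitMinimaxRisk_hatNet hk hd hle' ν (m := m) (δ := 32 * ε / √k)
      (by positivity) ?_ ?_
    · have h3 := hle2.trans hR
      rw [div_mul_cancel₀ _ (Real.sqrt_pos.2 hk0).ne', ENNReal.ofReal_le_ofReal_iff hε.le] at h3
      linarith
    · rw [hδ2, mul_div_cancel₀ _ hk0.ne']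
      nlinarith
    · rw [hδ2]
      have h5 : (m : ℝ) * (1024 * ε ^ 2 / k) ≤
          1 / 12288 * (k * Real.log (d / k) / ε ^ 2) * (1024 * ε ^ 2 / k) :=
        mul_le_mul_of_nonneg_right hlt.le (by positivity)
      have h6 : 1 / 12288 * (k * Real.log (d / k) / ε ^ 2) * (1024 * ε ^ 2 / k) =
          Real.log (d / k) / 12 := by
        field_simp
        norm_num
      linarith
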